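/- Let $F$ be a field, and let $\Omega$ be a set with maps $s,t\colon\Omega\to\mathbb Z_{\ge 0}$. An $\Omega$-algebra is a vector space $A$ over $F$ with a linear map $\omega_A\colon A^{\otimes s(\omega)}\to A^{\otimes t(\omega)}$ for every $\omega\in\Omega$ (where $A^{\otimes 0}:=F$). For a (coassociative counital) coalgebra $P$ and a linear map $\psi\colon P\otimes A\to A$ define $\psi_n\colon P\otimes A^{\otimes n}\to A^{\otimes n}$ by $\psi_0(p)=\varepsilon(p)$ and $\psi_n(p\otimes a_1\otimes\dots\otimes a_n)=\psi(p_{(1)}\otimes a_1)\otimes\dots\otimes\psi(p_{(n)}\otimes a_n)$. The map $\psi$ is a measuring if $\psi_{t(\omega)}(p\otimes\omega_A(x))=\omega_A(\psi_{s(\omega)}(p\otimes x))$ for all $\omega\in\Omega$, $p\in P$, $x\in A^{\otimes s(\omega)}$. Its cosupport is $\operatorname{cosupp}\psi=\{\psi(p\otimes -)\mid p\in P\}\subseteq\operatorname{End}_F(A)$. An action of a bialgebra $B$ on $A$ is a linear map $\psi\colon B\otimes A\to A$ that is both a unital left $B$-module structure on $A$ and a measuring. For a subspace $V\subseteq\operatorname{End}_F(A)$,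 a $V$-universal measuring coalgebra is a terminal object $({}_\square\mathcal B(A,V),\psi_{A,V})$ of the category whose objects are the pairs $(P,\psi)$ of a coalgebra $P$ and a measuring $\psi\colon P\otimes A\to A$ with $\operatorname{cosupp}\psi\subseteq V$, and whose morphisms $(P_1,\psi_1)\to(P_2,\psi_2)$ are the coalgebra homomorphisms $\varphi\colon P_1\to P_2$ with $\psi_2(\varphi\otimes\mathrm{id}_A)=\psi_1$. Theorem. Let $A$ be an $\Omega$-algebra and let $V\subseteq\operatorname{End}_F(A)$ be a unital subalgebra. Then a $V$-universal measuring coalgebra $({}_\square\mathcal B(A,V),\psi_{A,V})$ exists, and every such coalgebra admits a structure of a bialgebra, with the given comultiplication and counit, such that $\psi_{A,V}$ is an action and such that for every bialgebra $B$ and every action $\psi\colon B\otimes A\to A$ with $\operatorname{cosupp}\psi\subseteq V$ the unique coalgebra homomorphism $\varphi\colon B\to{}_\square\mathcal B(A,V)$ with $\psi_{A,V}(\varphi\otimes\mathrm{id}_A)=\psi$ is a bialgebra homomorphism. -/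

import Mathlib

open scoped TensorProduct

universe u v v' w x

namespace OmegaAlg

noncomputable section

/-- An `Ω`-algebra structure on the vector space `A`, for a set `Ω` of operation symbols with
arities `s` and coarities `t`: a linear map `A^{⊗ s ω} → A^{⊗ t ω}` for each `ω`. Here
`⨂[F]^n A` is the `n`-th tensor power, and `⨂[F]^0 A` is canonically `F`. -/
structure OmegaAlgebra (F : Type u) [Field F] {Ω : Type x} (s t : Ω → ℕ)
    (A : Type v) [AddCommGroup A] [Module F A] where
  /-- The operation of the symbol `ω`. -/
  op : ∀ ω : Ω, (⨂[F]^(s ω) A) →ₗ[F] (⨂[F]^(t ω) A)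

/-- Iterated comultiplication `P → P^{⊗ n}`, `p ↦ p₍₁₎ ⊗ ⋯ ⊗ p₍ₙ₎`; it is the counit for
`n = 0`, and in general `Δ⁽ⁿ⁺¹⁾ = (Δ⁽ⁿ⁾ ⊗ id) ∘ Δ`. -/
def iteratedComul (F : Type u) [Field F] (P : Type w) [AddCommGroup P] [Module F P]
    [Coalgebra F P] : (n : ℕ) → (P →ₗ[F] ⨂[F]^n P)
  | 0 => (PiTensorProduct.isEmptyEquiv (R := F) (s := fun _ : Fin 0 => P) (Fin 0)).symm.toLinearMap
      ∘ₗ Coalgebra.counit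
  | n + 1 =>
      TensorPower.mulEquiv.toLinearMap
        ∘ₗ TensorProduct.map (iteratedComul F P n)
            (PiTensorProduct.subsingletonEquiv (R := F) (s := fun _ : Fin 1 => P)
              (0 : Fin 1)).symm.toLinearMap
        ∘ₗ Coalgebra.comul

section Measurings

variable {F : Type u} [Field F] {A : Type v} [AddCommGroup A] [Module F A]
  {B : Type v'} [AddCommGroup B] [Module F B]
  {P : Type w} [AddCommGroup P] [Module F P]

/-- The cosupport of `ψ : P ⊗ A → B`: the set of all maps `a ↦ ψ (p ⊗ a)`, `p ∈ P`. -/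
def cosupp (ψ : P ⊗[F] A →ₗ[F] B) : Submodule F (A →ₗ[F] B) :=
  LinearMap.range (TensorProduct.curry ψ)

/-- The map `ψₙ : P ⊗ A^{⊗ n} → B^{⊗ n}`, in curried form:
`ψₙ p (a₁ ⊗ ⋯ ⊗ aₙ) = ψ (p₍₁₎ ⊗ a₁) ⊗ ⋯ ⊗ ψ (p₍ₙ₎ ⊗ aₙ)`, and `ψ₀ p = ε p`. -/
def psiPow [Coalgebra F P] (ψ : P ⊗[F] A →ₗ[F] B) (n : ℕ) :
    P →ₗ[F] (⨂[F]^n A) →ₗ[F] (⨂[F]^n B) :=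
  PiTensorProduct.piTensorHomMap
    ∘ₗ PiTensorProduct.map (fun _ : Fin n => TensorProduct.curry ψ)
    ∘ₗ iteratedComul F P n

variable {Ω : Type x} {s t : Ω → ℕ}

/-- `ψ : P ⊗ A → B` is a measuring from the `Ω`-algebra `A` to the `Ω`-algebra `B`. -/
def IsMeasuring [Coalgebra F P] (𝓐 : OmegaAlgebra F s t A) (𝓑 : OmegaAlgebra F s t B)
    (ψ : P ⊗[F] A →ₗ[F] B) : Prop :=
  ∀ (ω : Ω) (p : P) (a : ⨂[F]^(s ω) A),
    psiPow ψ (t ω) p (𝓐.op ω a) = 𝓑.op ω (psiPow ψ (s ω) p a)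

/-- `(C, ψ)` is a `V`-universal measuring coalgebra from `A` to `B`: a terminal object of the
category of all pairs `(P, ψ')` of a coalgebra `P` and a measuring `ψ' : P ⊗ A → B` with
cosupport in `V`, where a morphism is a coalgebra homomorphism compatible with the measurings. -/
def IsUniversalMeasuring (𝓐 : OmegaAlgebra F s t A) (𝓑 : OmegaAlgebra F s t B)
    (V : Submodule F (A →ₗ[F] B)) (C : Type w) [AddCommGroup C] [Module F C] [Coalgebra F C]
    (ψ : C ⊗[F] A →ₗ[F] B) : Prop :=
  IsMeasuring 𝓐 𝓑 ψ ∧ cosupp ψ ≤ V ∧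
    ∀ (P : Type w) [AddCommGroup P] [Module F P] [Coalgebra F P] (ψ' : P ⊗[F] A →ₗ[F] B),
      IsMeasuring 𝓐 𝓑 ψ' → cosupp ψ' ≤ V →
        ∃! φ : P →ₗc[F] C, ψ ∘ₗ LinearMap.rTensor A φ.toLinearMap = ψ'

/-- `ψ : H ⊗ A → A` is an action of the bialgebra `H` on the `Ω`-algebra `A`: it makes `A` a
unital left `H`-module, and it is a measuring. -/
structure IsAction {H : Type w} [Ring H] [Bialgebra F H] (𝓐 : OmegaAlgebra F s t A)
    (ψ : H ⊗[F] A →ₗ[F] A) : Prop where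
  one_act : ∀ a : A, ψ (1 ⊗ₜ[F] a) = a
  mul_act : ∀ (h k : H) (a : A), ψ ((h * k) ⊗ₜ[F] a) = ψ (h ⊗ₜ[F] ψ (k ⊗ₜ[F] a))
  measuring : IsMeasuring 𝓐 𝓐 ψ

end Measurings

/-- A bialgebra structure on a given coalgebra `C`: a multiplication and an identity element that
make `C` a unital associative algebra whose comultiplication and counit are algebra
homomorphisms. -/
structure BialgebraStructure (F : Type u) [Field F] (C : Type w) [AddCommGroup C] [Module F C]
    [Coalgebra F C] where
  mul : C →ₗ[F] C →ₗ[F] C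
  one : C
  mul_assoc : ∀ a b c : C, mul (mul a b) c = mul a (mul b c)
  one_mul : ∀ a : C, mul one a = a
  mul_one : ∀ a : C, mul a one = a
  counit_one : Coalgebra.counit (R := F) one = 1
  counit_mul : ∀ a b : C, Coalgebra.counit (R := F) (mul a b) =
    Coalgebra.counit (R := F) a * Coalgebra.counit (R := F) b
  comul_one : Coalgebra.comul (R := F) one = one ⊗ₜ[F] one
  comul_mul : ∀ a b : C, Coalgebra.comul (R := F) (mul a b) =
    TensorProduct.map₂ mul mul (Coalgebra.comul (R := F) a) (Coalgebra.comul (R := F) b)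

namespace BialgebraStructure

variable {F : Type u} [Field F] {C : Type w} [AddCommGroup C] [Module F C] [Coalgebra F C]

/-- The ring `C`, with the given addition. -/
abbrev toRing (S : BialgebraStructure F C) : Ring C :=
  { ‹AddCommGroup C› with
    mul := fun a b => S.mul a b
    one := S.one
    mul_assoc := S.mul_assoc
    one_mul := S.one_mul
    mul_one := S.mul_one
    left_distrib := fun a b c => map_add (S.mul a) b c
    right_distrib := fun a b c => by
      change S.mul (a + b) c = S.mul a c + S.mul b c
      rw [map_add, LinearMap.add_apply]
    zero_mul := fun a => by
      change S.mul 0 a = 0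
      rw [map_zero, LinearMap.zero_apply]
    mul_zero := fun a => map_zero (S.mul a) }

/-- The `F`-algebra `C`, with the given scalar multiplication. -/
abbrev toAlgebra (S : BialgebraStructure F C) : @Algebra F C _ S.toRing.toSemiring :=
  letI := S.toRing
  Algebra.ofModule (fun r a b => by
      change S.mul (r • a) b = r • S.mul a b
      rw [map_smul, LinearMap.smul_apply])
    (fun r a b => map_smul (S.mul a) r b)

/-- The bialgebra `C`, with the given comultiplication and counit. -/
abbrev toBialgebra (S : BialgebraStructure F C) : @Bialgebra F C _ S.toRing.toSemiring :=
  letI := S.toRing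
  letI := S.toAlgebra
  Bialgebra.mk' F C (C := ‹Coalgebra F C›) S.counit_one (S.counit_mul _ _) S.comul_one
    (fun {a b} => by
      refine (S.comul_mul a b).trans ?_
      generalize (Coalgebra.comul (R := F) a : C ⊗[F] C) = y
      generalize (Coalgebra.comul (R := F) b : C ⊗[F] C) = z
      induction y using TensorProduct.induction_on with
      | zero => rw [map_zero, LinearMap.zero_apply]; exact (zero_mul z).symm
      | add y₁ y₂ h₁ h₂ =>
        rw [map_add, LinearMap.add_apply, h₁, h₂]; exact (add_mul y₁ y₂ z).symm
      | tmul a b =>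
        induction z using TensorProduct.induction_on with
        | zero => rw [map_zero]; exact (mul_zero _).symm
        | add z₁ z₂ h₁ h₂ => rw [map_add, h₁, h₂]; exact (mul_add _ z₁ z₂).symm
        | tmul c d => exact (Algebra.TensorProduct.tmul_mul_tmul (R := F) a c b d).symm)

end BialgebraStructure

end

end OmegaAlg

open OmegaAlg

/-! Existence combines a size bound with a rigidity property. Every element of a coalgebra lies in
the image of a finite-dimensional one (`exists_finite_coalgHom`), and the `V`-measurings on the
coalgebras with underlying space `Fⁿ` form a set. Their direct sum is again a `V`-measuring, given
by a map `θ` into `End A`. Let `C` be its quotient by the largest coideal in `ker θ`. The difference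
of two coalgebra homomorphisms has a coideal as its image, so a homomorphism into `C` is determined
by the measuring it induces (`coalgHom_ext_of_reducedMap`). For a `V`-measuring on `P`, reduce `P ×
C` in the same way: `C` still embeds because it is already reduced, and it fills the quotient
because each finite-dimensional piece of `P` already occurs in `C`. Inverting this embedding sends
`P` to `C`.

For the bialgebra structure, `V` is closed under composition and contains `1`. Hence `C ⊗ C`, acting
by composites, and `F`, acting by scalars, carry `V`-measurings. The induced homomorphisms into `C`
are the multiplication and the unit, so they respect the coalgebra structure by construction.
Associativity, the unit laws and compatibility with an acting bialgebra each equate homomorphisms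
into `C` that induce the same measuring, so uniqueness proves them. -/

namespace OmegaAlg

noncomputable section

open TensorProduct

/-! ### Action of a coalgebra on tensor powers -/

section PsiPow

variable {F : Type*} [Field F] {A : Type*} [AddCommGroup A] [Module F A]
  {B : Type*} [AddCommGroup B] [Module F B]
  {P : Type*} [AddCommGroup P] [Module F P]
  {Q : Type*} [AddCommGroup Q] [Module F Q]

theorem mulEquiv_tprod_tmul_tprod {n m : ℕ} (a : Fin n → A) (b : Fin m → A) :
    TensorPower.mulEquiv (PiTensorProduct.tprod F a ⊗ₜ[F] PiTensorProduct.tprod F b) =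
      PiTensorProduct.tprod F (Fin.append a b) :=
  TensorPower.tprod_mul_tprod F a b

/-- Factorwise action respects concatenation of tensors. By multilinearity all four arguments may be
taken pure, where it is a fact about `Fin.append`. -/
theorem piTensorHomMap_map_mulEquiv (f : P →ₗ[F] A →ₗ[F] B) {n m : ℕ}
    (u : ⨂[F]^n P) (w : ⨂[F]^m P) (y : ⨂[F]^n A) (z : ⨂[F]^m A) :
    PiTensorProduct.piTensorHomMap
        (PiTensorProduct.map (fun _ => f) (TensorPower.mulEquiv (u ⊗ₜ[F] w)))
        (TensorPower.mulEquiv (y ⊗ₜ[F] z)) =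
      TensorPower.mulEquiv
        (PiTensorProduct.piTensorHomMap (PiTensorProduct.map (fun _ => f) u) y ⊗ₜ[F]
          PiTensorProduct.piTensorHomMap (PiTensorProduct.map (fun _ => f) w) z) := by
  induction u using PiTensorProduct.induction_on with
  | add u₁ u₂ h₁ h₂ => simp only [add_tmul, map_add, LinearMap.add_apply, h₁, h₂]
  | smul_tprod r p =>
  induction w using PiTensorProduct.induction_on with
  | add u₁ u₂ h₁ h₂ => simp only [tmul_add, map_add, LinearMap.add_apply, h₁, h₂]
  | smul_tprod r' q =>
  induction y using PiTensorProduct.induction_on with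
  | add u₁ u₂ h₁ h₂ => simp only [add_tmul, map_add, h₁, h₂]
  | smul_tprod s a =>
  induction z using PiTensorProduct.induction_on with
  | add u₁ u₂ h₁ h₂ => simp only [tmul_add, map_add, h₁, h₂]
  | smul_tprod s' b =>
  simp only [← smul_tmul', tmul_smul, map_smul, LinearMap.smul_apply, mulEquiv_tprod_tmul_tprod,
    PiTensorProduct.map_tprod, PiTensorProduct.piTensorHomMap_tprod_tprod]
  have : (fun i => f (Fin.append p q i) (Fin.append a b i)) =
      Fin.append (fun i => f (p i) (a i)) fun i => f (q i) (b i) := by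
    funext i
    refine Fin.addCases (fun i => ?_) (fun i => ?_) i <;> simp
  simp only [this, smul_smul]
  congr 1
  ring

/-- The action of `p` on the first tensor power, without use of the comultiplication. -/
def psiOne (ψ : P ⊗[F] A →ₗ[F] B) : P →ₗ[F] (⨂[F]^1 A) →ₗ[F] (⨂[F]^1 B) :=
  PiTensorProduct.piTensorHomMap
    ∘ₗ PiTensorProduct.map (fun _ : Fin 1 => TensorProduct.curry ψ)
    ∘ₗ (PiTensorProduct.subsingletonEquiv (R := F) (s := fun _ : Fin 1 => P)
        (0 : Fin 1)).symm.toLinearMap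

theorem psiOne_tprod (ψ : P ⊗[F] A →ₗ[F] B) (p : P) (a : Fin 1 → A) :
    psiOne ψ p (PiTensorProduct.tprod F a) = PiTensorProduct.tprod F fun i => ψ (p ⊗ₜ[F] a i) := by
  have : (PiTensorProduct.subsingletonEquiv (R := F) (s := fun _ : Fin 1 => P) (0 : Fin 1)).symm p
      = PiTensorProduct.tprod F fun _ => p := by
    rw [LinearEquiv.symm_apply_eq]
    simp
  simp [psiOne, this]

/-- The composite `P ⊗ Q ⊗ A → A` of two maps `P ⊗ A → A` and `Q ⊗ A → A`. -/
def compAct (ψ : P ⊗[F] A →ₗ[F] A) (χ : Q ⊗[F] A →ₗ[F] A) : (P ⊗[F] Q) ⊗[F] A →ₗ[F] A :=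
  ψ ∘ₗ LinearMap.lTensor P χ ∘ₗ (TensorProduct.assoc F P Q A).toLinearMap

@[simp]
theorem compAct_tmul (ψ : P ⊗[F] A →ₗ[F] A) (χ : Q ⊗[F] A →ₗ[F] A) (p : P) (q : Q) (a : A) :
    compAct ψ χ ((p ⊗ₜ[F] q) ⊗ₜ[F] a) = ψ (p ⊗ₜ[F] χ (q ⊗ₜ[F] a)) := rfl

variable [Coalgebra F P] [Coalgebra F Q]

theorem psiPow_zero (ψ : P ⊗[F] A →ₗ[F] A) (p : P) (a : ⨂[F]^0 A) :
    psiPow ψ 0 p a = Coalgebra.counit (R := F) p • a := by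
  induction a using PiTensorProduct.induction_on with
  | add u₁ u₂ h₁ h₂ => simp only [map_add, smul_add, h₁, h₂]
  | smul_tprod r a =>
  have : (PiTensorProduct.isEmptyEquiv (R := F) (s := fun _ : Fin 0 => P) (Fin 0)).symm
      (Coalgebra.counit (R := F) p) =
        Coalgebra.counit (R := F) p • PiTensorProduct.tprod F isEmptyElim := rfl
  simp only [psiPow, iteratedComul, LinearMap.comp_apply, LinearEquiv.coe_coe, map_smul, this,
    PiTensorProduct.map_tprod, LinearMap.smul_apply, PiTensorProduct.piTensorHomMap_tprod_tprod]
  rw [smul_comm]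
  congr 4
  exact Subsingleton.elim _ _

/-- Splitting off the last factor is the recursion behind the inductions on tensor powers. That
factor is acted on by `psiOne`, because `psiPow ψ 1` would bring in a comultiplication followed by a
counit. -/
theorem psiPow_succ (ψ : P ⊗[F] A →ₗ[F] B) (n : ℕ) (p : P) (y : ⨂[F]^n A) (z : ⨂[F]^1 A) :
    psiPow ψ (n + 1) p (TensorPower.mulEquiv (y ⊗ₜ[F] z)) =
      TensorPower.mulEquiv (homTensorHomMap (RingHom.id F) _ _ _ _ (map (psiPow ψ n) (psiOne ψ)
        (Coalgebra.comul (R := F) p)) (y ⊗ₜ[F] z)) := by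
  simp only [psiPow, iteratedComul, LinearMap.comp_apply, LinearEquiv.coe_coe]
  generalize (Coalgebra.comul (R := F) p : P ⊗[F] P) = c
  induction c using TensorProduct.induction_on with
  | zero => simp
  | add c₁ c₂ h₁ h₂ => simp only [map_add, LinearMap.add_apply, h₁, h₂]
  | tmul p q =>
    simp only [map_tmul, piTensorHomMap_map_mulEquiv, homTensorHomMap_apply]
    rfl

/-- No scalar case is needed: scalars are absorbed into the arbitrary tensor `y`. -/
theorem tensorPower_succ_induction {n : ℕ} {p : (⨂[F]^(n + 1) A) → Prop}
    (hp : ∀ (y : ⨂[F]^n A) (a : Fin 1 → A),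
      p (TensorPower.mulEquiv (y ⊗ₜ[F] PiTensorProduct.tprod F a)))
    (hadd : ∀ y z, p y → p z → p (y + z)) (x : ⨂[F]^(n + 1) A) : p x := by
  obtain ⟨x, rfl⟩ := (TensorPower.mulEquiv (R := F) (M := A) (n := n) (m := 1)).surjective x
  induction x using TensorProduct.induction_on with
  | zero => simpa using hp 0 0
  | add _ _ h₁ h₂ => simpa using hadd _ _ h₁ h₂
  | tmul y z =>
    induction z using PiTensorProduct.induction_on with
    | add _ _ h₁ h₂ => simpa [tmul_add] using hadd _ _ h₁ h₂
    | smul_tprod r a =>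
      rw [tmul_smul, smul_tmul']
      exact hp _ _

/-- A coalgebra homomorphism commutes with iterated comultiplication; this lets measurings be pulled
back. -/
theorem psiPow_comp_coalgHom (ψ : Q ⊗[F] A →ₗ[F] A) (φ : P →ₗc[F] Q) (n : ℕ) (p : P) :
    psiPow (ψ ∘ₗ LinearMap.rTensor A φ.toLinearMap) n p = psiPow ψ n (φ p) := by
  have key : psiPow (ψ ∘ₗ LinearMap.rTensor A φ.toLinearMap) n =
      psiPow ψ n ∘ₗ φ.toLinearMap := by
    induction n with
    | zero =>
      ext1 p
      refine LinearMap.ext fun a => ?_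
      simp [psiPow_zero]
    | succ n ih =>
      ext1 p
      refine LinearMap.ext fun a => ?_
      induction a using tensorPower_succ_induction with
      | hadd y z hy hz => simp only [map_add, hy, hz]
      | hp y a =>
        have h1 : psiOne (ψ ∘ₗ LinearMap.rTensor A φ.toLinearMap) =
            psiOne ψ ∘ₗ φ.toLinearMap := by
          ext1 p
          ext a
          simp [psiOne_tprod]
        rw [LinearMap.comp_apply, psiPow_succ, psiPow_succ, ih, h1, map_comp, LinearMap.comp_apply]
        congr 4
        exact CoalgHomClass.map_comp_comul_apply φ p
  rw [key]; rfl

/-- The comultiplication of `P ⊗ Q` pairs the legs of `p` with those of `q`, so each tensor factor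
sees a composite. Composites of measurings are therefore measurings. -/
theorem psiPow_compAct (ψ : P ⊗[F] A →ₗ[F] A) (χ : Q ⊗[F] A →ₗ[F] A) (n : ℕ) (p : P) (q : Q)
    (a : ⨂[F]^n A) :
    psiPow (compAct ψ χ) n (p ⊗ₜ[F] q) a = psiPow ψ n p (psiPow χ n q a) := by
  induction n generalizing p q with
  | zero => simp [psiPow_zero, smul_smul, mul_comm]
  | succ n ih =>
    induction a using tensorPower_succ_induction with
    | hadd y z hy hz => simp only [map_add, hy, hz]
    | hp y a =>
      rw [psiPow_succ, psiPow_succ, TensorProduct.comul_tmul]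
      generalize (Coalgebra.comul (R := F) q : Q ⊗[F] Q) = d
      induction d using TensorProduct.induction_on with
      | zero => simp
      | add c₁ c₂ h₁ h₂ => simp only [map_add, LinearMap.add_apply, h₁, h₂, tmul_add]
      | tmul q q' =>
        simp only [map_tmul, homTensorHomMap_apply, psiPow_succ]
        generalize (Coalgebra.comul (R := F) p : P ⊗[F] P) = c
        induction c using TensorProduct.induction_on with
        | zero => simp
        | add c₁ c₂ h₁ h₂ => simp only [map_add, LinearMap.add_apply, h₁, h₂, add_tmul]
        | tmul p p' =>
          simp [psiOne_tprod, ih]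

end PsiPow

/-! ### Local finiteness of coalgebras over a field -/

section Fundamental

variable {F : Type*} [Field F] {M : Type*} [AddCommGroup M] [Module F M]
  {N : Type*} [AddCommGroup N] [Module F N]

/-- Evaluation of the left tensor factor at a functional. -/
def evalLeft (f : M →ₗ[F] F) : M ⊗[F] N →ₗ[F] N :=
  (TensorProduct.lid F N).toLinearMap ∘ₗ LinearMap.rTensor N f

/-- Evaluation of the right tensor factor at a functional. -/
def evalRight (g : N →ₗ[F] F) : M ⊗[F] N →ₗ[F] M :=
  (TensorProduct.rid F M).toLinearMap ∘ₗ LinearMap.lTensor M g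

@[simp]
theorem evalLeft_tmul (f : M →ₗ[F] F) (a : M) (b : N) : evalLeft f (a ⊗ₜ[F] b) = f a • b := rfl

@[simp]
theorem evalRight_tmul (g : N →ₗ[F] F) (a : M) (b : N) : evalRight g (a ⊗ₜ[F] b) = g b • a := rfl

/-- The coordinate functionals of a basis of `M` already separate tensors. -/
theorem eq_of_evalLeft_eq {y z : M ⊗[F] N} (h : ∀ f : M →ₗ[F] F, evalLeft f y = evalLeft f z) :
    y = z := by
  classical
  let b := Module.Basis.ofVectorSpace F M
  apply (TensorProduct.equivFinsuppOfBasisLeft (N := N) b).injective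
  ext i
  have key (z : M ⊗[F] N) :
      TensorProduct.equivFinsuppOfBasisLeft b z i = evalLeft (b.coord i) z := by
    rw [TensorProduct.equivFinsuppOfBasisLeft_apply]; rfl
  rw [key, key, h]

theorem evalRight_eq_evalLeft_comm (f : N →ₗ[F] F) (y : M ⊗[F] N) :
    evalRight f y = evalLeft f (TensorProduct.comm F M N y) := by
  induction y using TensorProduct.induction_on with
  | zero => simp
  | add y z hy hz => simp only [map_add, hy, hz]
  | tmul a b => simp

theorem eq_of_evalRight_eq {y z : M ⊗[F] N} (h : ∀ f : N →ₗ[F] F, evalRight f y = evalRight f z) :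
    y = z := by
  apply (TensorProduct.comm F M N).injective
  refine eq_of_evalLeft_eq fun f => ?_
  rw [← evalRight_eq_evalLeft_comm, h, evalRight_eq_evalLeft_comm]

theorem exists_finite_forall_evalLeft_mem (y : M ⊗[F] N) :
    ∃ W : Submodule F N, FiniteDimensional F W ∧ ∀ f : M →ₗ[F] F, evalLeft f y ∈ W := by
  induction y using TensorProduct.induction_on with
  | zero => exact ⟨⊥, inferInstance, by simp⟩
  | add y z hy hz =>
    obtain ⟨V, _, hV⟩ := hy
    obtain ⟨W, _, hW⟩ := hz
    refine ⟨V ⊔ W, inferInstance, fun f => ?_⟩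
    rw [map_add]
    exact Submodule.add_mem_sup (hV f) (hW f)
  | tmul a b =>
    exact ⟨Submodule.span F {b}, inferInstance, fun f =>
      Submodule.smul_mem _ _ (Submodule.mem_span_singleton_self b)⟩

theorem exists_finite_forall_evalRight_mem (y : M ⊗[F] N) :
    ∃ W : Submodule F M, FiniteDimensional F W ∧ ∀ f : N →ₗ[F] F, evalRight f y ∈ W := by
  simpa only [evalRight_eq_evalLeft_comm] using
    exists_finite_forall_evalLeft_mem (TensorProduct.comm F M N y)

variable {P : Type*} [AddCommGroup P] [Module F P] [Coalgebra F P]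

/-- The action `p ↦ f(p₁) p₂` of the functional `f`. -/
def coactLeft (f : P →ₗ[F] F) : P →ₗ[F] P := evalLeft f ∘ₗ Coalgebra.comul

/-- The action `p ↦ p₁ g(p₂)` of the functional `g`. -/
def coactRight (g : P →ₗ[F] F) : P →ₗ[F] P := evalRight g ∘ₗ Coalgebra.comul

/-- The convolution product of two functionals. -/
def functionalConv (f g : P →ₗ[F] F) : P →ₗ[F] F :=
  LinearMap.mul' F F ∘ₗ TensorProduct.map f g ∘ₗ Coalgebra.comul

theorem coactLeft_counit (p : P) : coactLeft (Coalgebra.counit (R := F)) p = p := by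
  exact (congrArg (TensorProduct.lid F P) (Coalgebra.rTensor_counit_comul (R := F) p)).trans
    (by simp)

theorem coactRight_counit (p : P) : coactRight (Coalgebra.counit (R := F)) p = p := by
  exact (congrArg (TensorProduct.rid F P) (Coalgebra.lTensor_counit_comul (R := F) p)).trans
    (by simp)

theorem comul_evalLeft (f : P →ₗ[F] F) (y : P ⊗[F] P) :
    Coalgebra.comul (R := F) (evalLeft f y) =
      evalLeft f (LinearMap.lTensor P Coalgebra.comul y) := by
  induction y using TensorProduct.induction_on with
  | zero => simp
  | add y z hy hz => simp only [map_add, hy, hz]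
  | tmul a b => simp

theorem comul_evalRight (f : P →ₗ[F] F) (y : P ⊗[F] P) :
    Coalgebra.comul (R := F) (evalRight f y) =
      evalRight f (LinearMap.rTensor P Coalgebra.comul y) := by
  induction y using TensorProduct.induction_on with
  | zero => simp
  | add y z hy hz => simp only [map_add, hy, hz]
  | tmul a b => simp

/-- Coassociativity. With the next two lemmas it makes `P` a bimodule over its convolution dual. -/
theorem coactLeft_coactLeft (f h : P →ₗ[F] F) (p : P) :
    coactLeft h (coactLeft f p) = coactLeft (functionalConv f h) p := by
  have key : (evalLeft h ∘ₗ evalLeft f) ∘ₗ (TensorProduct.assoc F P P P).toLinearMap =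
      evalLeft (LinearMap.mul' F F ∘ₗ TensorProduct.map f h) := by
    ext a b c
    simp [smul_smul]
  have key' : evalLeft (functionalConv f h) = evalLeft (LinearMap.mul' F F ∘ₗ
      TensorProduct.map f h) ∘ₗ LinearMap.rTensor P (Coalgebra.comul (R := F) (A := P)) := by
    ext a b
    rfl
  simp only [coactLeft, LinearMap.comp_apply, comul_evalLeft, ← Coalgebra.coassoc_apply, key']
  exact LinearMap.congr_fun key _

theorem coactRight_coactRight (g h : P →ₗ[F] F) (p : P) :
    coactRight h (coactRight g p) = coactRight (functionalConv h g) p := by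
  have key : (evalRight h ∘ₗ evalRight g) ∘ₗ (TensorProduct.assoc F P P P).symm.toLinearMap =
      evalRight (LinearMap.mul' F F ∘ₗ TensorProduct.map h g) := by
    refine TensorProduct.ext (LinearMap.ext fun a => TensorProduct.ext' fun b c => ?_)
    simp [smul_smul, mul_comm (g c)]
  have key' : evalRight (functionalConv h g) = evalRight (LinearMap.mul' F F ∘ₗ
      TensorProduct.map h g) ∘ₗ LinearMap.lTensor P (Coalgebra.comul (R := F) (A := P)) := by
    ext a b
    rfl
  simp only [coactRight, LinearMap.comp_apply, comul_evalRight, ← Coalgebra.coassoc_symm_apply,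
    key']
  exact LinearMap.congr_fun key _

theorem coactLeft_coactRight (f g : P →ₗ[F] F) (p : P) :
    coactLeft f (coactRight g p) = coactRight g (coactLeft f p) := by
  have key : evalLeft f ∘ₗ evalRight g =
      (evalRight g ∘ₗ evalLeft f) ∘ₗ (TensorProduct.assoc F P P P).toLinearMap := by
    ext a b c
    simp [smul_comm (f a)]
  simp only [coactLeft, coactRight, LinearMap.comp_apply, comul_evalRight, comul_evalLeft,
    ← Coalgebra.coassoc_apply]
  exact LinearMap.congr_fun key _

/-- The sub-bimodule generated by `p` works; it is finite-dimensional because `Δ p`, and then `Δ y`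
for finitely many `y`, are finite sums of pure tensors. -/
theorem exists_finite_coact_stable (p : P) :
    ∃ Q : Submodule F P, FiniteDimensional F Q ∧ p ∈ Q ∧
      (∀ f : P →ₗ[F] F, ∀ q ∈ Q, coactLeft f q ∈ Q) ∧ ∀ g : P →ₗ[F] F, ∀ q ∈ Q, coactRight g q ∈ Q := by
  let Q : Submodule F P :=
    Submodule.span F (Set.range fun fg : (P →ₗ[F] F) × (P →ₗ[F] F) =>
      coactRight fg.2 (coactLeft fg.1 p))
  have mem (f g) : coactRight g (coactLeft f p) ∈ Q := Submodule.subset_span ⟨(f, g), rfl⟩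
  refine ⟨Q, ?_, ?_, fun h => ?_, fun h => ?_⟩
  · obtain ⟨W, hW, hpW⟩ := exists_finite_forall_evalLeft_mem (Coalgebra.comul (R := F) p)
    obtain ⟨s, rfl⟩ := Module.Finite.iff_fg.mp hW
    -- The span of `s` contains every `f(p₁) p₂`, and `T y` contains every `y₁ g(y₂)`; by linearity
    -- `s.sup T` contains all generators of `Q`.
    choose T hT hmem using fun y : P =>
      exists_finite_forall_evalRight_mem (Coalgebra.comul (R := F) y)
    have hle : Q ≤ s.sup T := by
      refine Submodule.span_le.mpr ?_
      rintro _ ⟨⟨f, g⟩, rfl⟩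
      have : Submodule.span F (s : Set P) ≤ (s.sup T).comap (coactRight g) :=
        Submodule.span_le.mpr fun y hy =>
          (Finset.le_sup (f := T) hy) (hmem y g)
      exact this (hpW f)
    have : FiniteDimensional F (s.sup T : Submodule F P) := Submodule.finite_finset_sup s T
    exact Submodule.finiteDimensional_of_le hle
  -- `p` is the generator with both functionals equal to the counit.
  · simpa only [coactLeft_counit, coactRight_counit] using
      mem Coalgebra.counit Coalgebra.counit
  · have : Q ≤ Q.comap (coactLeft h) := by
      refine Submodule.span_le.mpr ?_
      rintro _ ⟨⟨f, g⟩, rfl⟩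
      simpa only [Submodule.comap_coe, Set.mem_preimage, SetLike.mem_coe, coactLeft_coactRight,
        coactLeft_coactLeft] using mem _ _
    exact this
  · have : Q ≤ Q.comap (coactRight h) := by
      refine Submodule.span_le.mpr ?_
      rintro _ ⟨⟨f, g⟩, rfl⟩
      simpa only [Submodule.comap_coe, Set.mem_preimage, SetLike.mem_coe,
        coactRight_coactRight] using mem _ _
    exact this

/-- For a projection `π` onto `Q` this expresses `Δ q ∈ Q ⊗ Q`. It holds one leg at a time:
evaluating the other leg at a functional lands in `Q`, which `π` fixes, and functionals separate
tensors. -/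
theorem map_comul_eq_of_coact_stable {Q : Submodule F P}
    (hl : ∀ f : P →ₗ[F] F, ∀ q ∈ Q, coactLeft f q ∈ Q)
    (hr : ∀ g : P →ₗ[F] F, ∀ q ∈ Q, coactRight g q ∈ Q)
    (π : P →ₗ[F] P) (hπ : ∀ q ∈ Q, π q = q) {q : P} (hq : q ∈ Q) :
    TensorProduct.map π π (Coalgebra.comul (R := F) q) = Coalgebra.comul (R := F) q := by
  have h1 : LinearMap.lTensor P π (Coalgebra.comul (R := F) q) = Coalgebra.comul (R := F) q := by
    refine eq_of_evalLeft_eq fun f => ?_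
    have : evalLeft f ∘ₗ LinearMap.lTensor P π = π ∘ₗ evalLeft f := by ext; simp
    exact (LinearMap.congr_fun this _).trans (hπ _ (hl f q hq))
  have h2 : LinearMap.rTensor P π (Coalgebra.comul (R := F) q) = Coalgebra.comul (R := F) q := by
    refine eq_of_evalRight_eq fun f => ?_
    have : evalRight f ∘ₗ LinearMap.rTensor P π = π ∘ₗ evalRight f := by ext; simp
    exact (LinearMap.congr_fun this _).trans (hπ _ (hr f q hq))
  rw [← LinearMap.rTensor_comp_lTensor, LinearMap.comp_apply, h1, h2]

/-- The coalgebra structure on a retract of a coalgebra which is closed under the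
comultiplication. -/
abbrev coalgebraOfRetract (i : M →ₗ[F] P) (r : P →ₗ[F] M) (hr : r ∘ₗ i = LinearMap.id)
    (h : TensorProduct.map (i ∘ₗ r) (i ∘ₗ r) ∘ₗ Coalgebra.comul ∘ₗ i = Coalgebra.comul ∘ₗ i) :
    Coalgebra F M where
  comul := TensorProduct.map r r ∘ₗ Coalgebra.comul ∘ₗ i
  counit := Coalgebra.counit ∘ₗ i
  coassoc := by
    have h1 : LinearMap.rTensor M (TensorProduct.map r r ∘ₗ Coalgebra.comul ∘ₗ i) ∘ₗ
        TensorProduct.map r r ∘ₗ Coalgebra.comul ∘ₗ i = TensorProduct.map (TensorProduct.map r r) r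
          ∘ₗ LinearMap.rTensor P Coalgebra.comul ∘ₗ Coalgebra.comul ∘ₗ i := by
      -- Inserting `i ∘ r` on both legs lets `r ∘ i = id` collapse the two sides to the same map.
      conv_rhs => rw [← h]
      simp only [← LinearMap.comp_assoc, LinearMap.rTensor, ← TensorProduct.map_comp, hr,
        LinearMap.id_comp]
    have h2 : LinearMap.lTensor M (TensorProduct.map r r ∘ₗ Coalgebra.comul ∘ₗ i) ∘ₗ
        TensorProduct.map r r ∘ₗ Coalgebra.comul ∘ₗ i = TensorProduct.map r (TensorProduct.map r r)
          ∘ₗ LinearMap.lTensor P Coalgebra.comul ∘ₗ Coalgebra.comul ∘ₗ i := by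
      conv_rhs => rw [← h]
      simp only [← LinearMap.comp_assoc, LinearMap.lTensor, ← TensorProduct.map_comp, hr,
        LinearMap.id_comp]
    rw [h1, h2]
    rw [← LinearMap.comp_assoc, ← TensorProduct.map_map_comp_assoc_eq]
    ext1 m
    exact congrArg (TensorProduct.map r (TensorProduct.map r r)) (Coalgebra.coassoc_apply (i m))
  rTensor_counit_comp_comul := by
    have h1 : LinearMap.rTensor M (Coalgebra.counit ∘ₗ i) ∘ₗ TensorProduct.map r r ∘ₗ
        Coalgebra.comul ∘ₗ i = LinearMap.lTensor F r ∘ₗ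
          LinearMap.rTensor P Coalgebra.counit ∘ₗ Coalgebra.comul ∘ₗ i := by
      conv_rhs => rw [← h]
      simp only [← LinearMap.comp_assoc, LinearMap.rTensor, LinearMap.lTensor,
        ← TensorProduct.map_comp, hr, LinearMap.id_comp]
    rw [h1]
    ext m
    simpa using congrArg ((1 : F) ⊗ₜ[F] ·) (LinearMap.congr_fun hr m)
  lTensor_counit_comp_comul := by
    have h1 : LinearMap.lTensor M (Coalgebra.counit ∘ₗ i) ∘ₗ TensorProduct.map r r ∘ₗ
        Coalgebra.comul ∘ₗ i = LinearMap.rTensor F r ∘ₗ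
          LinearMap.lTensor P Coalgebra.counit ∘ₗ Coalgebra.comul ∘ₗ i := by
      conv_rhs => rw [← h]
      simp only [← LinearMap.comp_assoc, LinearMap.rTensor, LinearMap.lTensor,
        ← TensorProduct.map_comp, hr, LinearMap.id_comp]
    rw [h1]
    ext m
    simpa using congrArg (· ⊗ₜ[F] (1 : F)) (LinearMap.congr_fun hr m)

/-- The space `Fⁿ`, without its standard coalgebra structure. -/
def Vec (F : Type*) (n : ℕ) : Type _ := Fin n → F

instance (n : ℕ) : AddCommGroup (Vec F n) := inferInstanceAs (AddCommGroup (Fin n → F))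

instance (n : ℕ) : Module F (Vec F n) := inferInstanceAs (Module F (Fin n → F))

/-- The stable subspace is transported to `Fⁿ` so that the finite-dimensional coalgebras needed
later range over a set. -/
theorem exists_finite_coalgHom (p : P) :
    ∃ (n : ℕ) (_ : Coalgebra F (Vec F n)) (φ : Vec F n →ₗc[F] P), p ∈ Set.range φ := by
  obtain ⟨Q, _, hp, hl, hr⟩ := exists_finite_coact_stable (F := F) p
  let e : Q ≃ₗ[F] Vec F (Module.finrank F Q) := (Module.finBasis F Q).equivFun
  obtain ⟨r, hr'⟩ := Q.exists_isCompl.elim fun Q' h =>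
    (⟨Q.projectionOnto Q' h, fun q => Submodule.projectionOnto_apply_left h q⟩ :
      ∃ r : P →ₗ[F] Q, ∀ q : Q, r q = q)
  have h1 : (e.toLinearMap ∘ₗ r) ∘ₗ (Q.subtype ∘ₗ e.symm.toLinearMap) = LinearMap.id := by
    ext1 y
    simp [hr']
  have h2 : TensorProduct.map ((Q.subtype ∘ₗ e.symm.toLinearMap) ∘ₗ (e.toLinearMap ∘ₗ r))
      ((Q.subtype ∘ₗ e.symm.toLinearMap) ∘ₗ (e.toLinearMap ∘ₗ r)) ∘ₗ Coalgebra.comul ∘ₗ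
        (Q.subtype ∘ₗ e.symm.toLinearMap) = Coalgebra.comul ∘ₗ
          (Q.subtype ∘ₗ e.symm.toLinearMap) := by
    ext1 y
    refine map_comul_eq_of_coact_stable hl hr _ (fun q hq => ?_) (e.symm y).2
    simpa using congrArg Subtype.val (hr' ⟨q, hq⟩)
  let c : Coalgebra F (Vec F (Module.finrank F Q)) := coalgebraOfRetract _ _ h1 h2
  refine ⟨_, c, ⟨Q.subtype ∘ₗ e.symm.toLinearMap, rfl, ?_⟩, e ⟨p, hp⟩, ?_⟩
  · change TensorProduct.map _ _ ∘ₗ TensorProduct.map _ _ ∘ₗ Coalgebra.comul ∘ₗ _ = _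
    rw [← LinearMap.comp_assoc, ← TensorProduct.map_comp]
    exact h2
  · exact congrArg Subtype.val (e.symm_apply_apply ⟨p, hp⟩)

end Fundamental

/-! ### The subspace where the measuring conditions hold -/

section Measurings

variable {F : Type*} [Field F] {Ω : Type*} {s t : Ω → ℕ} {A : Type*} [AddCommGroup A] [Module F A]
  (𝓐 : OmegaAlgebra F s t A) (V : Submodule F (A →ₗ[F] A))
  {P : Type*} [AddCommGroup P] [Module F P] [Coalgebra F P]
  {Q : Type*} [AddCommGroup Q] [Module F Q] [Coalgebra F Q]

/-- The elements of `P` at which the `V`-measuring conditions hold. -/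
def measuringLocus (ψ : P ⊗[F] A →ₗ[F] A) : Submodule F P where
  carrier := {p | TensorProduct.curry ψ p ∈ V ∧ ∀ (ω : Ω) (a : ⨂[F]^(s ω) A),
    psiPow ψ (t ω) p (𝓐.op ω a) = 𝓐.op ω (psiPow ψ (s ω) p a)}
  zero_mem' := by simp
  add_mem' := by
    rintro p q ⟨hp, hp'⟩ ⟨hq, hq'⟩
    refine ⟨?_, fun ω a => ?_⟩
    · rw [map_add]; exact V.add_mem hp hq
    · simp only [map_add, LinearMap.add_apply, hp', hq']
  smul_mem' := by
    rintro c p ⟨hp, hp'⟩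
    refine ⟨?_, fun ω a => ?_⟩
    · rw [map_smul]; exact V.smul_mem c hp
    · simp only [map_smul, LinearMap.smul_apply, hp']

variable {𝓐 V}

theorem mem_measuringLocus {ψ : P ⊗[F] A →ₗ[F] A} {p : P} :
    p ∈ measuringLocus 𝓐 V ψ ↔ TensorProduct.curry ψ p ∈ V ∧ ∀ (ω : Ω) (a : ⨂[F]^(s ω) A),
      psiPow ψ (t ω) p (𝓐.op ω a) = 𝓐.op ω (psiPow ψ (s ω) p a) := Iff.rfl

/-- The conditions are linear in `p`, so being a `V`-measuring can be tested on a spanning set. -/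
theorem measuringLocus_eq_top_iff {ψ : P ⊗[F] A →ₗ[F] A} :
    measuringLocus 𝓐 V ψ = ⊤ ↔ IsMeasuring 𝓐 𝓐 ψ ∧ cosupp ψ ≤ V := by
  rw [Submodule.eq_top_iff']
  constructor
  · intro h
    refine ⟨fun ω p a => (h p).2 ω a, ?_⟩
    rintro _ ⟨p, rfl⟩
    exact (h p).1
  · exact fun h p => ⟨h.2 ⟨p, rfl⟩, fun ω a => h.1 ω p a⟩

theorem measuringLocus_comp_coalgHom (ψ : Q ⊗[F] A →ₗ[F] A) (φ : P →ₗc[F] Q) :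
    measuringLocus 𝓐 V (ψ ∘ₗ LinearMap.rTensor A φ.toLinearMap) =
      (measuringLocus 𝓐 V ψ).comap φ.toLinearMap := by
  ext p
  simp only [Submodule.mem_comap, mem_measuringLocus, psiPow_comp_coalgHom]
  rfl

end Measurings

/-! ### Coideals and reduced quotients -/

section Reduced

variable {F : Type*} [Field F] {P : Type*} [AddCommGroup P] [Module F P] [Coalgebra F P]
  {Q : Type*} [AddCommGroup Q] [Module F Q] [Coalgebra F Q]

/-- The projection modulo the sum factors through each `P ⧸ I`, where the comultiplication of `I`
already vanishes. -/
theorem isCoideal_sSup (S : Set (Submodule F P)) (hS : ∀ I ∈ S, I.IsCoideal) :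
    (sSup S).IsCoideal := by
  rw [Submodule.isCoideal_iff]
  have h1 : sSup S ≤ LinearMap.ker (Coalgebra.counit (R := F) (A := P)) :=
    sSup_le fun I hI p hp => (hS I hI).counit_eq_zero hp
  have h2 : sSup S ≤ LinearMap.ker (TensorProduct.map (sSup S).mkQ (sSup S).mkQ ∘ₗ
      Coalgebra.comul (R := F) (A := P)) := by
    refine sSup_le fun I hI p hp => ?_
    have : (sSup S).mkQ = I.mapQ (sSup S) LinearMap.id (le_sSup hI) ∘ₗ I.mkQ := rfl
    rw [LinearMap.mem_ker, this, TensorProduct.map_comp, LinearMap.comp_apply, LinearMap.comp_apply,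
      (hS I hI).map_mkQ_comul_eq_zero hp, map_zero]
  exact ⟨fun p hp => h1 hp, fun p hp => h2 hp⟩

theorem isCoideal_ker_of_surjective (f : P →ₗc[F] Q) (hf : Function.Surjective f) :
    (LinearMap.ker f.toLinearMap).IsCoideal := by
  have h : (LinearMap.ker f.toLinearMap).mkQ =
      (f.toLinearMap.quotKerEquivOfSurjective hf).symm.toLinearMap ∘ₗ f.toLinearMap := by
    ext p
    exact ((LinearEquiv.symm_apply_eq _).mpr rfl).symm
  refine ⟨fun p hp => ?_, fun p hp => ?_⟩
  · rw [← CoalgHomClass.counit_comp_apply f p]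
    exact (congrArg _ hp).trans (map_zero _)
  · have hp' : TensorProduct.map f.toLinearMap f.toLinearMap (Coalgebra.comul (R := F) p) = 0 :=
      (CoalgHomClass.map_comp_comul_apply f p).trans ((congrArg _ hp).trans (map_zero _))
    rw [h, TensorProduct.map_comp, LinearMap.comp_apply, hp', map_zero]

/-- Modulo the range `f` and `g` agree, hence so do the two images of `Δ p`. -/
theorem isCoideal_range_sub (f g : P →ₗc[F] Q) :
    (LinearMap.range (f.toLinearMap - g.toLinearMap)).IsCoideal := by
  set I := LinearMap.range (f.toLinearMap - g.toLinearMap)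
  have hI : I.mkQ ∘ₗ f.toLinearMap = I.mkQ ∘ₗ g.toLinearMap := by
    ext p
    exact (Submodule.Quotient.eq I).mpr ⟨p, rfl⟩
  rw [Submodule.isCoideal_iff]
  constructor
  · rintro _ ⟨p, rfl⟩
    have h1 := CoalgHomClass.counit_comp_apply f p
    have h2 := CoalgHomClass.counit_comp_apply g p
    rw [LinearMap.sub_apply, map_sub]
    exact sub_eq_zero.mpr (h1.trans h2.symm)
  · rintro _ ⟨p, rfl⟩
    rw [LinearMap.sub_apply, map_sub, map_sub, sub_eq_zero]
    have key (f : P →ₗc[F] Q) : TensorProduct.map I.mkQ I.mkQ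
        (Coalgebra.comul (R := F) (f.toLinearMap p)) = TensorProduct.map (I.mkQ ∘ₗ f.toLinearMap)
          (I.mkQ ∘ₗ f.toLinearMap) (Coalgebra.comul (R := F) p) := by
      rw [TensorProduct.map_comp, LinearMap.comp_apply]
      exact congrArg _ (CoalgHomClass.map_comp_comul_apply f p).symm
    rw [key, key, hI]

/-- The sum of all coideals contained in the kernel of `θ`. -/
def largestCoideal {E : Type*} [AddCommGroup E] [Module F E] (θ : P →ₗ[F] E) : Submodule F P :=
  sSup {I | I.IsCoideal ∧ I ≤ LinearMap.ker θ}

variable {E : Type*} [AddCommGroup E] [Module F E]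

instance (θ : P →ₗ[F] E) : (largestCoideal θ).IsCoideal :=
  isCoideal_sSup _ fun _ h => h.1

theorem largestCoideal_le_ker (θ : P →ₗ[F] E) : largestCoideal θ ≤ LinearMap.ker θ :=
  sSup_le fun _ h => h.2

/-- The map induced by `θ` on the quotient by the largest coideal in its kernel. -/
def reducedMap (θ : P →ₗ[F] E) : P ⧸ largestCoideal θ →ₗ[F] E :=
  (largestCoideal θ).liftQ θ (largestCoideal_le_ker θ)

/-- The preimage of `J` in `P` is a coideal inside `ker θ`, hence inside the largest one. -/
theorem eq_bot_of_isCoideal_of_le_ker_reducedMap (θ : P →ₗ[F] E)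
    (J : Submodule F (P ⧸ largestCoideal θ)) [J.IsCoideal]
    (hJ : J ≤ LinearMap.ker (reducedMap θ)) : J = ⊥ := by
  let f : P →ₗc[F] (P ⧸ largestCoideal θ) ⧸ J :=
    (Coalgebra.Quotient.mkQCoalgHom J).comp (Coalgebra.Quotient.mkQCoalgHom (largestCoideal θ))
  have hf : Function.Surjective f :=
    (Submodule.mkQ_surjective J).comp (Submodule.mkQ_surjective (largestCoideal θ))
  have h1 : LinearMap.ker f.toLinearMap ≤ LinearMap.ker θ := fun p hp =>
    hJ ((Submodule.Quotient.mk_eq_zero J).mp hp)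
  have h2 : LinearMap.ker f.toLinearMap ≤ largestCoideal θ :=
    le_sSup ⟨isCoideal_ker_of_surjective f hf, h1⟩
  rw [eq_bot_iff]
  intro x hx
  obtain ⟨p, rfl⟩ := Submodule.mkQ_surjective _ x
  exact (Submodule.Quotient.mk_eq_zero _).mpr (h2 ((Submodule.Quotient.mk_eq_zero J).mpr hx))

theorem coalgHom_ext_of_reducedMap (θ : P →ₗ[F] E) (f g : Q →ₗc[F] P ⧸ largestCoideal θ)
    (h : reducedMap θ ∘ₗ f.toLinearMap = reducedMap θ ∘ₗ g.toLinearMap) : f = g := by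
  have := isCoideal_range_sub f g
  have h0 := eq_bot_of_isCoideal_of_le_ker_reducedMap θ
    (LinearMap.range (f.toLinearMap - g.toLinearMap)) (by
      rintro _ ⟨q, rfl⟩
      rw [LinearMap.mem_ker, LinearMap.sub_apply, map_sub, sub_eq_zero]
      exact LinearMap.congr_fun h q)
  ext q
  exact sub_eq_zero.mp (LinearMap.congr_fun (LinearMap.range_eq_bot.mp h0) q)

theorem injective_of_reducedMap (θ : P →ₗ[F] E) (f : P ⧸ largestCoideal θ →ₗc[F] Q)
    (hf : Function.Surjective f) (η : Q →ₗ[F] E) (h : η ∘ₗ f.toLinearMap = reducedMap θ) :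
    Function.Injective f := by
  have := isCoideal_ker_of_surjective f hf
  refine LinearMap.ker_eq_bot.mp (eq_bot_of_isCoideal_of_le_ker_reducedMap θ
    (LinearMap.ker f.toLinearMap) fun x hx => ?_)
  rw [LinearMap.mem_ker, ← h, LinearMap.comp_apply, hx, map_zero]

end Reduced

/-! ### The sum of all finite-dimensional measurings -/

section Existence

variable {F : Type u} [Field F] {Ω : Type x} {s t : Ω → ℕ} {A : Type v} [AddCommGroup A]
  [Module F A] (𝓐 : OmegaAlgebra F s t A) (V : Submodule F (A →ₗ[F] A))

/-- A `V`-measuring on a coalgebra with underlying space `Fⁿ`. -/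
structure FiniteMeasuring where
  dim : ℕ
  coalg : Coalgebra F (Vec F dim)
  map : Vec F dim ⊗[F] A →ₗ[F] A
  locus_eq_top : measuringLocus 𝓐 V map = ⊤

instance (i : FiniteMeasuring 𝓐 V) : Coalgebra F (Vec F i.dim) := i.coalg

open scoped Classical in
/-- The coproduct of all finite-dimensional `V`-measurings. -/
abbrev FiniteMeasuringSum : Type (max u v w) :=
  Π₀ i : ULift.{w} (FiniteMeasuring 𝓐 V), Vec F i.down.dim

open scoped Classical in
/-- The universal measuring, in curried form, before passing to the reduced quotient. -/
def finiteMeasuringSumMap : FiniteMeasuringSum.{u, v, w} 𝓐 V →ₗ[F] A →ₗ[F] A :=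
  DFinsupp.lsum F fun i => TensorProduct.curry i.down.map

end Existence

/-! ### Inclusions into direct sums of coalgebras -/

section CoalgHoms

variable {F : Type*} [Field F]

/-- The inclusion of a summand of a direct sum of coalgebras. -/
def singleCoalgHom {ι : Type*} [DecidableEq ι] {P : ι → Type*} [∀ i, AddCommGroup (P i)]
    [∀ i, Module F (P i)] [∀ i, Coalgebra F (P i)] (i : ι) : P i →ₗc[F] Π₀ i, P i where
  toLinearMap := DFinsupp.lsingle i
  counit_comp := DFinsupp.counit_comp_lsingle F ι P i
  map_comp_comul := (DFinsupp.comul_comp_lsingle F ι P i).symm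

variable {P : Type*} [AddCommGroup P] [Module F P] [Coalgebra F P]
  {Q : Type*} [AddCommGroup Q] [Module F Q] [Coalgebra F Q]

variable (F P Q) in
/-- The inclusion of the left summand. -/
def inlCoalgHom : P →ₗc[F] P × Q where
  toLinearMap := LinearMap.inl F P Q
  counit_comp := Prod.counit_comp_inl F P Q
  map_comp_comul := (Prod.comul_comp_inl F P Q).symm

variable (F P Q) in
/-- The inclusion of the right summand. -/
def inrCoalgHom : Q →ₗc[F] P × Q where
  toLinearMap := LinearMap.inr F P Q
  counit_comp := Prod.counit_comp_inr F P Q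
  map_comp_comul := (Prod.comul_comp_inr F P Q).symm

end CoalgHoms

/-! ### Measurings as maps into the endomorphisms -/

section Lift

variable {F : Type*} [Field F] {Ω : Type*} {s t : Ω → ℕ} {A : Type*} [AddCommGroup A] [Module F A]
  {𝓐 : OmegaAlgebra F s t A} {V : Submodule F (A →ₗ[F] A)}
  {P : Type*} [AddCommGroup P] [Module F P]
  {Q : Type*} [AddCommGroup Q] [Module F Q]

theorem lift_comp_rTensor_eq_iff {θ : Q →ₗ[F] A →ₗ[F] A} {φ : P →ₗ[F] Q}
    {ψ : P ⊗[F] A →ₗ[F] A} :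
    TensorProduct.lift θ ∘ₗ LinearMap.rTensor A φ = ψ ↔ θ ∘ₗ φ = TensorProduct.curry ψ := by
  constructor
  · rintro rfl
    ext p a
    rfl
  · intro h
    refine TensorProduct.ext' fun p a => ?_
    exact LinearMap.congr_fun (LinearMap.congr_fun h p) a

variable [Coalgebra F P] [Coalgebra F Q]

theorem range_le_measuringLocus {θ : Q →ₗ[F] A →ₗ[F] A} (φ : P →ₗc[F] Q)
    (h : measuringLocus 𝓐 V (TensorProduct.lift (θ ∘ₗ φ.toLinearMap)) = ⊤) :
    LinearMap.range φ.toLinearMap ≤ measuringLocus 𝓐 V (TensorProduct.lift θ) := by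
  have h1 : TensorProduct.lift θ ∘ₗ LinearMap.rTensor A φ.toLinearMap =
      TensorProduct.lift (θ ∘ₗ φ.toLinearMap) :=
    lift_comp_rTensor_eq_iff.mpr rfl
  rw [← h1, measuringLocus_comp_coalgHom] at h
  rintro _ ⟨p, rfl⟩
  exact h.ge (Submodule.mem_top (x := p))

theorem measuringLocus_reducedMap {θ : P →ₗ[F] A →ₗ[F] A}
    (h : measuringLocus 𝓐 V (TensorProduct.lift θ) = ⊤) :
    measuringLocus 𝓐 V (TensorProduct.lift (reducedMap θ)) = ⊤ := by
  refine top_le_iff.mp (le_trans ?_ (range_le_measuringLocus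
    (Coalgebra.Quotient.mkQCoalgHom (largestCoideal θ)) h))
  exact (Submodule.range_mkQ _).ge

end Lift

/-! ### Existence of the universal measuring coalgebra -/

section Existence

variable {F : Type u} [Field F] {Ω : Type x} {s t : Ω → ℕ} {A : Type v} [AddCommGroup A]
  [Module F A] (𝓐 : OmegaAlgebra F s t A) (V : Submodule F (A →ₗ[F] A))

open scoped Classical in
theorem measuringLocus_finiteMeasuringSumMap :
    measuringLocus 𝓐 V (TensorProduct.lift (finiteMeasuringSumMap.{u, v, w} 𝓐 V)) = ⊤ := by
  rw [Submodule.eq_top_iff']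
  intro d
  induction d using DFinsupp.induction with
  | h0 => exact Submodule.zero_mem _
  | ha i p d _ _ hd =>
    refine Submodule.add_mem _ ?_ hd
    refine range_le_measuringLocus (singleCoalgHom (P := fun i : ULift.{w} (FiniteMeasuring 𝓐 V) =>
      Vec F i.down.dim) i) ?_ ⟨p, rfl⟩
    have h : finiteMeasuringSumMap.{u, v, w} 𝓐 V ∘ₗ DFinsupp.lsingle i =
        TensorProduct.curry i.down.map := by
      ext1 q
      exact DFinsupp.lsum_single F
        (fun i : ULift.{w} (FiniteMeasuring 𝓐 V) => TensorProduct.curry i.down.map) i q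
    refine (congrArg (fun g => measuringLocus 𝓐 V (TensorProduct.lift g)) h).trans ?_
    refine Eq.trans (congrArg _ ?_) i.down.locus_eq_top
    exact TensorProduct.ext' fun p a => rfl

theorem exists_isUniversalMeasuring :
    ∃ (C : Type (max u v w)) (_ : AddCommGroup C) (_ : Module F C) (_ : Coalgebra F C)
      (ψ : C ⊗[F] A →ₗ[F] A), IsUniversalMeasuring 𝓐 𝓐 V C ψ := by
  classical
  let θ := finiteMeasuringSumMap.{u, v, w} 𝓐 V
  let C := FiniteMeasuringSum.{u, v, w} 𝓐 V ⧸ largestCoideal θ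
  have hC : measuringLocus 𝓐 V (TensorProduct.lift (reducedMap θ)) = ⊤ :=
    measuringLocus_reducedMap (measuringLocus_finiteMeasuringSumMap 𝓐 V)
  have hC' := measuringLocus_eq_top_iff.mp hC
  refine ⟨C, inferInstance, inferInstance, inferInstance, TensorProduct.lift (reducedMap θ),
    hC'.1, hC'.2, fun P _ _ _ ψ hψ hV => ?_⟩
  have htop : measuringLocus 𝓐 V ψ = ⊤ := measuringLocus_eq_top_iff.mpr ⟨hψ, hV⟩
  -- The reduced quotient of `P × C` compares `P` with `C`: `f` and `g` are the two maps into it,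
  -- and `g` will be an isomorphism.
  let η : P × C →ₗ[F] A →ₗ[F] A := (TensorProduct.curry ψ).coprod (reducedMap θ)
  let f : P →ₗc[F] (P × C) ⧸ largestCoideal η :=
    (Coalgebra.Quotient.mkQCoalgHom (largestCoideal η)).comp (inlCoalgHom F P C)
  let g : C →ₗc[F] (P × C) ⧸ largestCoideal η :=
    (Coalgebra.Quotient.mkQCoalgHom (largestCoideal η)).comp (inrCoalgHom F P C)
  have hf : reducedMap η ∘ₗ f.toLinearMap = TensorProduct.curry ψ :=
    LinearMap.coprod_inl (TensorProduct.curry ψ) (reducedMap θ)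
  have hg : reducedMap η ∘ₗ g.toLinearMap = reducedMap θ :=
    LinearMap.coprod_inr (TensorProduct.curry ψ) (reducedMap θ)
  have hfg (p : P) : f p ∈ LinearMap.range g.toLinearMap := by
    obtain ⟨n, _, φ, q, rfl⟩ := exists_finite_coalgHom (F := F) p
    -- A finite-dimensional coalgebra through `p`, with the restricted measuring, is one of the
    -- summands behind `C`. Its two routes into the reduced quotient induce the same measuring, so
    -- they agree.
    let i : ULift.{w} (FiniteMeasuring 𝓐 V) :=
      ⟨n, inferInstance, ψ ∘ₗ LinearMap.rTensor A φ.toLinearMap, by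
        rw [measuringLocus_comp_coalgHom, htop, Submodule.comap_top]⟩
    let k : Vec F n →ₗc[F] C := (Coalgebra.Quotient.mkQCoalgHom (largestCoideal θ)).comp
      (singleCoalgHom (P := fun i : ULift.{w} (FiniteMeasuring 𝓐 V) => Vec F i.down.dim) i)
    have hk : reducedMap θ ∘ₗ k.toLinearMap = TensorProduct.curry ψ ∘ₗ φ.toLinearMap := by
      ext1 q
      exact DFinsupp.lsum_single F
        (fun i : ULift.{w} (FiniteMeasuring 𝓐 V) => TensorProduct.curry i.down.map) i q
    have : f.comp φ = g.comp k := by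
      refine coalgHom_ext_of_reducedMap η _ _ ?_
      change (reducedMap η ∘ₗ f.toLinearMap) ∘ₗ φ.toLinearMap =
        (reducedMap η ∘ₗ g.toLinearMap) ∘ₗ k.toLinearMap
      rw [hf, hg, hk]
    exact ⟨k q, (CoalgHom.congr_fun this q).symm⟩
  -- The class of `(p, c)` is `f p + g c`, and both terms lie in the range of `g`.
  have hsurj : Function.Surjective g := by
    intro y
    obtain ⟨⟨p, c⟩, rfl⟩ := Submodule.mkQ_surjective _ y
    obtain ⟨c', hc'⟩ := hfg p
    refine ⟨c' + c, ?_⟩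
    rw [map_add]
    refine (congrArg (· + g c) hc').trans ?_
    change (largestCoideal η).mkQ (p, 0) + (largestCoideal η).mkQ (0, c) = _
    rw [← map_add, Prod.mk_add_mk, add_zero, zero_add]
  let e := CoalgEquiv.ofBijective (f := g) ⟨injective_of_reducedMap θ g hsurj _ hg, hsurj⟩
  refine ⟨(e.symm : _ →ₗc[F] C).comp f, ?_, fun φ hφ => ?_⟩
  · refine lift_comp_rTensor_eq_iff.mpr ?_
    rw [← hg, ← hf]
    ext1 p
    exact congrArg (reducedMap η) (e.apply_symm_apply (f p))
  · refine coalgHom_ext_of_reducedMap θ _ _ ?_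
    rw [lift_comp_rTensor_eq_iff.mp hφ, ← hf, ← hg]
    ext1 p
    exact congrArg (reducedMap η) (e.apply_symm_apply (f p)).symm

end Existence

/-! ### Group-like elements -/

section GroupLike

variable {F : Type u} [Field F]
  {P : Type*} [AddCommGroup P] [Module F P] [Coalgebra F P]
  {Q : Type*} [AddCommGroup Q] [Module F Q] [Coalgebra F Q]

/-- The coalgebra homomorphism from the ground field, placed in a larger universe, determined by a
group-like element. -/
def groupLikeCoalgHom {g : P} (hg : IsGroupLikeElem F g) : (PUnit.{w + 1} →₀ F) →ₗc[F] P where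
  toLinearMap := Finsupp.linearCombination F fun _ => g
  counit_comp := by
    ext
    simp [hg.counit_eq_one]
  map_comp_comul := by
    ext
    simp [hg.comul_eq_tmul_self]

@[simp]
theorem groupLikeCoalgHom_single {g : P} (hg : IsGroupLikeElem F g) (i : PUnit) (r : F) :
    groupLikeCoalgHom hg (Finsupp.single i r) = r • g :=
  Finsupp.linearCombination_single F r i

theorem isGroupLikeElem_single_punit :
    IsGroupLikeElem F (Finsupp.single PUnit.unit.{w + 1} (1 : F)) where
  counit_eq_one := by simp
  comul_eq_tmul_self := by simp

/-- The coalgebra homomorphism `p ↦ g ⊗ p` for a group-like element `g`. -/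
def groupLikeTmulLeft {g : Q} (hg : IsGroupLikeElem F g) : P →ₗc[F] Q ⊗[F] P where
  toLinearMap := TensorProduct.mk F Q P g
  counit_comp := by
    ext p
    simp [hg.counit_eq_one]
  map_comp_comul := by
    ext p
    simp only [LinearMap.comp_apply, TensorProduct.mk_apply, TensorProduct.comul_tmul,
      hg.comul_eq_tmul_self]
    generalize (Coalgebra.comul (R := F) p : P ⊗[F] P) = c
    induction c using TensorProduct.induction_on with
    | zero => simp
    | add c d hc hd => simp only [map_add, tmul_add, hc, hd]
    | tmul a b => simp

/-- The coalgebra homomorphism `p ↦ p ⊗ g` for a group-like element `g`. -/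
def groupLikeTmulRight {g : Q} (hg : IsGroupLikeElem F g) : P →ₗc[F] P ⊗[F] Q where
  toLinearMap := (TensorProduct.mk F P Q).flip g
  counit_comp := by
    ext p
    simp [hg.counit_eq_one]
  map_comp_comul := by
    ext p
    simp only [LinearMap.comp_apply, LinearMap.flip_apply, TensorProduct.mk_apply,
      TensorProduct.comul_tmul, hg.comul_eq_tmul_self]
    generalize (Coalgebra.comul (R := F) p : P ⊗[F] P) = c
    induction c using TensorProduct.induction_on with
    | zero => simp
    | add c d hc hd => simp only [map_add, add_tmul, hc, hd]
    | tmul a b => simp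

variable {A : Type*} [AddCommGroup A] [Module F A]

theorem psiPow_of_isGroupLikeElem {g : P} (hg : IsGroupLikeElem F g) {ψ : P ⊗[F] A →ₗ[F] A}
    (hψ : ∀ a, ψ (g ⊗ₜ[F] a) = a) (n : ℕ) (a : ⨂[F]^n A) : psiPow ψ n g a = a := by
  induction n with
  | zero => rw [psiPow_zero, hg.counit_eq_one, one_smul]
  | succ n ih =>
    induction a using tensorPower_succ_induction with
    | hadd y z hy hz => rw [map_add, hy, hz]
    | hp y a => simp [psiPow_succ, hg.comul_eq_tmul_self, ih, psiOne_tprod, hψ]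

end GroupLike

/-! ### Composites and the identity as measurings -/

section Loci

variable {F : Type*} [Field F] {Ω : Type*} {s t : Ω → ℕ} {A : Type*} [AddCommGroup A] [Module F A]
  {𝓐 : OmegaAlgebra F s t A} {V : Subalgebra F (Module.End F A)}
  {P : Type*} [AddCommGroup P] [Module F P] [Coalgebra F P]
  {Q : Type*} [AddCommGroup Q] [Module F Q] [Coalgebra F Q]

theorem measuringLocus_compAct {ψ : P ⊗[F] A →ₗ[F] A} {χ : Q ⊗[F] A →ₗ[F] A}
    (hψ : measuringLocus 𝓐 (Subalgebra.toSubmodule V) ψ = ⊤)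
    (hχ : measuringLocus 𝓐 (Subalgebra.toSubmodule V) χ = ⊤) :
    measuringLocus 𝓐 (Subalgebra.toSubmodule V) (compAct ψ χ) = ⊤ := by
  rw [Submodule.eq_top_iff'] at *
  intro y
  induction y using TensorProduct.induction_on with
  | zero => exact Submodule.zero_mem _
  | add y z hy hz => exact Submodule.add_mem _ hy hz
  | tmul p q =>
    refine ⟨V.mul_mem (hψ p).1 (hχ q).1, fun ω a => ?_⟩
    rw [psiPow_compAct, psiPow_compAct, (hχ q).2, (hψ p).2]

theorem mem_measuringLocus_of_isGroupLikeElem {g : P} (hg : IsGroupLikeElem F g)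
    {ψ : P ⊗[F] A →ₗ[F] A} (hψ : ∀ a, ψ (g ⊗ₜ[F] a) = a) :
    g ∈ measuringLocus 𝓐 (Subalgebra.toSubmodule V) ψ := by
  refine ⟨?_, fun ω a => ?_⟩
  · have : TensorProduct.curry ψ g = (1 : Module.End F A) := LinearMap.ext hψ
    rw [this]
    exact V.one_mem
  · rw [psiPow_of_isGroupLikeElem hg hψ, psiPow_of_isGroupLikeElem hg hψ]

end Loci

/-! ### Bialgebra structure from the universal property -/

section Universal

variable {F : Type u} [Field F] {Ω : Type x} {s t : Ω → ℕ} {A : Type v} [AddCommGroup A]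
  [Module F A] {𝓐 : OmegaAlgebra F s t A} {C : Type (max u v w)} [AddCommGroup C] [Module F C]
  [Coalgebra F C] {ψ : C ⊗[F] A →ₗ[F] A}

namespace IsUniversalMeasuring

section Submodule

variable {V : Submodule F (A →ₗ[F] A)} (h : IsUniversalMeasuring 𝓐 𝓐 V C ψ)

include h

theorem measuringLocus_eq_top : measuringLocus 𝓐 V ψ = ⊤ :=
  measuringLocus_eq_top_iff.mpr ⟨h.1, h.2.1⟩

theorem exists_hom {P : Type (max u v w)} [AddCommGroup P] [Module F P] [Coalgebra F P]
    {χ : P ⊗[F] A →ₗ[F] A} (hχ : measuringLocus 𝓐 V χ = ⊤) :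
    ∃ φ : P →ₗc[F] C, ∀ p a, ψ (φ p ⊗ₜ[F] a) = χ (p ⊗ₜ[F] a) := by
  obtain ⟨hm, hV⟩ := measuringLocus_eq_top_iff.mp hχ
  obtain ⟨φ, hφ, -⟩ := h.2.2 P χ hm hV
  exact ⟨φ, fun p a => LinearMap.congr_fun hφ (p ⊗ₜ[F] a)⟩

theorem hom_ext {P : Type (max u v w)} [AddCommGroup P] [Module F P] [Coalgebra F P]
    {φ φ' : P →ₗc[F] C} (heq : ∀ p a, ψ (φ p ⊗ₜ[F] a) = ψ (φ' p ⊗ₜ[F] a)) : φ = φ' := by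
  have hφ : measuringLocus 𝓐 V (ψ ∘ₗ LinearMap.rTensor A φ.toLinearMap) = ⊤ := by
    rw [measuringLocus_comp_coalgHom, h.measuringLocus_eq_top, Submodule.comap_top]
  obtain ⟨hm, hV⟩ := measuringLocus_eq_top_iff.mp hφ
  exact (h.2.2 P _ hm hV).unique rfl (TensorProduct.ext' fun p a => (heq p a).symm)

/-- Group-like elements correspond to homomorphisms from the ground field, so uniqueness of
homomorphisms applies to them. -/
theorem eq_of_isGroupLikeElem {c d : C} (hc : IsGroupLikeElem F c) (hd : IsGroupLikeElem F d)
    (heq : ∀ a, ψ (c ⊗ₜ[F] a) = ψ (d ⊗ₜ[F] a)) : c = d := by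
  have key : groupLikeCoalgHom.{u, max u v w} hc = groupLikeCoalgHom hd := by
    refine h.hom_ext fun p a => ?_
    induction p using Finsupp.induction_linear with
    | zero => simp
    | add p q hp hq => simp only [map_add, add_tmul, hp, hq]
    | single i r => simp [← smul_tmul', heq]
  simpa using CoalgHom.congr_fun key (Finsupp.single PUnit.unit 1)

end Submodule

theorem exists_bialgebraStructure {V : Subalgebra F (Module.End F A)}
    (h : IsUniversalMeasuring 𝓐 𝓐 (Subalgebra.toSubmodule V) C ψ) :
    ∃ S : BialgebraStructure F C, (∀ a, ψ (S.one ⊗ₜ[F] a) = a) ∧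
      (∀ c d a, ψ (S.mul c d ⊗ₜ[F] a) = ψ (c ⊗ₜ[F] ψ (d ⊗ₜ[F] a))) ∧
      ∃ μ : C ⊗[F] C →ₗc[F] C, ∀ c d, S.mul c d = μ (c ⊗ₜ[F] d) := by
  -- The ground field, moved to the universe in which `C` is universal, acts by scalars; the image
  -- of its generator will be the identity of `C`.
  let υ : (PUnit.{max u v w + 1} →₀ F) ⊗[F] A →ₗ[F] A :=
    TensorProduct.lift (Finsupp.linearCombination F fun _ => LinearMap.id)
  have hυ : measuringLocus 𝓐 (Subalgebra.toSubmodule V) υ = ⊤ := by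
    rw [Submodule.eq_top_iff']
    intro p
    induction p using Finsupp.induction_linear with
    | zero => exact Submodule.zero_mem _
    | add p q hp hq => exact Submodule.add_mem _ hp hq
    | single i r =>
      have h1 : Finsupp.single i r = r • Finsupp.single PUnit.unit (1 : F) := by simp
      rw [h1]
      exact Submodule.smul_mem _ _ (mem_measuringLocus_of_isGroupLikeElem
        isGroupLikeElem_single_punit fun a => by simp [υ])
  obtain ⟨η, hη⟩ := h.exists_hom hυ
  obtain ⟨μ, hμ⟩ := h.exists_hom
    (measuringLocus_compAct h.measuringLocus_eq_top h.measuringLocus_eq_top)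
  have hone : IsGroupLikeElem F (η (Finsupp.single PUnit.unit 1)) :=
    isGroupLikeElem_single_punit.map η
  set e := η (Finsupp.single PUnit.unit 1)
  have he (a : A) : ψ (e ⊗ₜ[F] a) = a := (hη _ a).trans (by simp [υ])
  have hmul (c d : C) (a : A) : ψ (μ (c ⊗ₜ[F] d) ⊗ₜ[F] a) = ψ (c ⊗ₜ[F] ψ (d ⊗ₜ[F] a)) :=
    hμ _ a
  -- Both sides induce `b ⊗ c ⊗ d ⊗ a ↦ b (c (d a))`.
  have hassoc : μ.comp (CoalgHom.rTensor C μ) = (μ.comp (CoalgHom.lTensor C μ)).comp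
      (Coalgebra.TensorProduct.assoc F F C C C : (C ⊗[F] C) ⊗[F] C →ₗc[F] C ⊗[F] (C ⊗[F] C)) := by
    refine h.hom_ext fun p a => ?_
    induction p using TensorProduct.induction_on with
    | zero => simp
    | add p q hp hq => simp only [map_add, add_tmul, hp, hq]
    | tmul p d =>
      induction p using TensorProduct.induction_on with
      | zero => simp
      | add p q hp hq => simp only [map_add, add_tmul, hp, hq]
      | tmul b c => simp [hmul]
  have hl : μ.comp (groupLikeTmulLeft hone) = CoalgHom.id F C :=
    h.hom_ext fun c a => (hmul e c a).trans (he _)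
  have hr : μ.comp (groupLikeTmulRight hone) = CoalgHom.id F C :=
    h.hom_ext fun c a => (hmul c e a).trans (by rw [he]; rfl)
  refine ⟨{
    mul := TensorProduct.curry μ.toLinearMap
    one := e
    mul_assoc := fun a b c => CoalgHom.congr_fun hassoc ((a ⊗ₜ[F] b) ⊗ₜ[F] c)
    one_mul := CoalgHom.congr_fun hl
    mul_one := CoalgHom.congr_fun hr
    counit_one := hone.counit_eq_one
    counit_mul := fun a b => (CoalgHomClass.counit_comp_apply μ (a ⊗ₜ[F] b)).trans
      -- The counit of `a ⊗ₜ b` unfolds to the product in the opposite order.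
      (mul_comm _ _)
    comul_one := hone.comul_eq_tmul_self
    comul_mul := fun a b => by
      refine (CoalgHomClass.map_comp_comul_apply μ (a ⊗ₜ[F] b)).symm.trans ?_
      rw [TensorProduct.comul_tmul]
      generalize (Coalgebra.comul (R := F) a : C ⊗[F] C) = y
      generalize (Coalgebra.comul (R := F) b : C ⊗[F] C) = z
      induction y using TensorProduct.induction_on with
      | zero => simp
      | add y₁ y₂ h₁ h₂ => simp only [add_tmul, map_add, LinearMap.add_apply, h₁, h₂]
      | tmul a b =>
        induction z using TensorProduct.induction_on with
        | zero => simp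
        | add y₁ y₂ h₁ h₂ => simp only [tmul_add, map_add, h₁, h₂]
        | tmul c d => rfl }, he, hmul, μ, fun _ _ => rfl⟩

end IsUniversalMeasuring

end Universal

end

end OmegaAlg

/-! ### Universality among bialgebra actions -/

theorem mainTheorem9 {F : Type u} [Field F] {Ω : Type x} {s t : Ω → ℕ}
    {A : Type v} [AddCommGroup A] [Module F A] (𝓐 : OmegaAlgebra F s t A)
    (V : Subalgebra F (Module.End F A)) :
    (∃ (C : Type (max u v w)) (_ : AddCommGroup C) (_ : Module F C) (_ : Coalgebra F C)
      (ψ : C ⊗[F] A →ₗ[F] A), IsUniversalMeasuring 𝓐 𝓐 (Subalgebra.toSubmodule V) C ψ) ∧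
    ∀ (C : Type (max u v w)) [AddCommGroup C] [Module F C] [Coalgebra F C]
      (ψC : C ⊗[F] A →ₗ[F] A),
      IsUniversalMeasuring 𝓐 𝓐 (Subalgebra.toSubmodule V) C ψC →
      ∃ S : BialgebraStructure F C,
        letI : Ring C := S.toRing
        letI : Bialgebra F C := S.toBialgebra
        IsAction 𝓐 ψC ∧
        ∀ (B : Type (max u v w)) [Ring B] [Bialgebra F B] (ψ : B ⊗[F] A →ₗ[F] A),
          IsAction 𝓐 ψ → cosupp ψ ≤ Subalgebra.toSubmodule V →
          ∃ Φ : B →ₐc[F] C,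
            ψC ∘ₗ LinearMap.rTensor A (Φ : B →ₗc[F] C).toLinearMap = ψ ∧
            ∀ φ : B →ₗc[F] C, ψC ∘ₗ LinearMap.rTensor A φ.toLinearMap = ψ →
              φ = (Φ : B →ₗc[F] C) := by
  refine ⟨exists_isUniversalMeasuring 𝓐 _, fun C _ _ _ ψC h => ?_⟩
  obtain ⟨S, hone, hmul, μ, hμ⟩ := h.exists_bialgebraStructure
  refine ⟨S, ?_⟩
  let : Ring C := S.toRing
  let : Bialgebra F C := S.toBialgebra
  refine ⟨⟨hone, hmul, h.1⟩, fun B _ _ ψ hψ hV => ?_⟩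
  obtain ⟨φ, hφ⟩ := h.exists_hom (measuringLocus_eq_top_iff.mpr ⟨hψ.measuring, hV⟩)
  -- Both elements are group-like and act as the identity.
  have h1 : φ 1 = S.one := by
    refine h.eq_of_isGroupLikeElem
      (IsGroupLikeElem.map φ ⟨Bialgebra.counit_one, Bialgebra.comul_one⟩)
      ⟨S.counit_one, S.comul_one⟩ fun a => ?_
    rw [hφ, hψ.one_act, hone]
  -- Multiplication in the bialgebra `B` is a coalgebra homomorphism, so both sides are
  -- homomorphisms `B ⊗ B → C`, and both induce `b ⊗ c ⊗ a ↦ b (c a)`.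
  have h2 : φ.comp (Bialgebra.mulCoalgHom F B) = μ.comp (Coalgebra.TensorProduct.map φ φ) := by
    refine h.hom_ext fun p a => ?_
    induction p using TensorProduct.induction_on with
    | zero => simp
    | add p q hp hq => simp only [map_add, TensorProduct.add_tmul, hp, hq]
    | tmul b c =>
      change ψC (φ (b * c) ⊗ₜ[F] a) = ψC (μ (φ b ⊗ₜ[F] φ c) ⊗ₜ[F] a)
      rw [hφ, hψ.mul_act, ← hμ, hmul, hφ, hφ]
  refine ⟨{ φ with
    map_one' := h1
    map_mul' := fun b c => (CoalgHom.congr_fun h2 (b ⊗ₜ[F] c)).trans (hμ _ _).symm },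
    TensorProduct.ext' hφ, fun χ hχ => ?_⟩
  exact h.hom_ext fun b a => (LinearMap.congr_fun hχ (b ⊗ₜ[F] a)).trans (hφ b a).symm
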